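/- Let $\Omega\subset\mathbb R^d$ be open and bounded, $T>0$, $\alpha>0$, and let $H_0^1(\Omega)$ be the closure of $C_c^\infty(\Omega)$ in the norm $\|v\|_{1,\Omega}=(\|v\|_{L^2(\Omega)}^2+\|\nabla v\|_{L^2(\Omega)}^2)^{1/2}$, with dual $H^{-1}(\Omega)$. Let $A=(a_{ij})$ with $a_{ij}=a_{ji}\in L^\infty(\Omega)$, let $a_0\in L^\infty(\Omega)$, let $\mathcal A v=-\nabla\cdot(A\nabla v)+a_0v$, and assume that for some $\gamma>0$ $$\int_\Omega A\nabla v\cdot\nabla v+a_0v^2\,dx\ \ge\ \gamma\|v\|_{1,\Omega}^2\qquad\forall v\in H_0^1(\Omega).$$ Let $\tilde f\in L^2(0,T;H^{-1}(\Omega))$, write $\Omega_T=(0,T]\times\Omega$, and put $P=\{v\in H^1(0,T;H_0^1(\Omega)) : v(T)=0\}$, $Q=L^2(0,T;H_0^1(\Omega))$, $$\begin{aligned}B_M((v_1,v_2),(w_1,w_2))={}&\int_{\Omega_T}(v_1)_t(w_1)_t+v_2w_2+a_0(v_2w_1-v_1w_2)\,dx\,dt+\int_{\Omega_T}A\nabla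 v_2\cdot\nabla w_1-A\nabla v_1\cdot\nabla w_2\,dx\,dt\\&+\int_\Omega A\nabla v_1(0)\cdot\nabla w_1(0)+\bigl(a_0+\tfrac1\alpha\bigr)v_1(0)w_1(0)\,dx,\end{aligned}$$ $$L_M(w_1,w_2)=\int_0^T\langle\tilde f(t),w_1(t)\rangle\,dt,\qquad \|(v_1,v_2)\|_M=\Bigl(\int_{\Omega_T}(v_1)_t^2+v_2^2\,dx\,dt\Bigr)^{1/2}.$$ Let $0=\tau_0<\tau_1<\dots<\tau_N=T$ be a time grid, $I_i=(\tau_{i-1},\tau_i]$, $\Delta\tau_i=\tau_i-\tau_{i-1}$, and let $P^k$ be the set of all $v\in P$ whose restriction to each $I_i$ is a polynomial of degree at most one in time. Let $(\tilde p,\tilde q)\in P\times Q$ satisfy $B_M((\tilde p,\tilde q),w)=L_M(w)$ for all $w\in P\times Q$ (mixed weak solution), and let $(\tilde p^k,\tilde q^k)\in P^k\times Q$ satisfy $B_M((\tilde p^k,\tilde q^k),w)=L_M(w)$ for all $w\in P^k\times Q$ (semi-time discrete solution). Then $$\|(\tilde p-\tilde p^k,\tilde q-\tilde q^k)\|_M^2\le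 C\,\eta^2,\qquad \eta^2=\sum_{i=1}^N\int_{I_i}\int_\Omega(\Delta\tau_i)^2\bigl(\tilde f+(\tilde p^k)_{tt}-\mathcal A\tilde q^k\bigr)^2dx\,dt,$$ where $C>0$ is an absolute constant (independent of all the data, of the grid and of the solutions). Here $(\tilde p^k)_{tt}$ is taken on each interval $I_i$ separately, and $\eta^2=\infty$ if the residual $\tilde f(t)+(\tilde p^k)_{tt}(t)-\mathcal A\tilde q^k(t)\in H^{-1}(\Omega)$ is not represented by a measurable function of $t$ with values in $L^2(\Omega)$. -/

import Mathlib

open MeasureTheory Set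
open scoped ENNReal ContDiff

noncomputable section

namespace MixedEvolution

/-- The Lebesgue space `L²(Ω)`. -/
abbrev L2 {d : ℕ} (Ω : Set (EuclideanSpace ℝ (Fin d))) : Type :=
  Lp ℝ 2 (volume.restrict Ω)

/-- The ambient Hilbert space `L²(Ω) × L²(Ω; ℝᵈ)` of pairs (function, gradient field), with the
norm `(‖u‖² + ‖g‖²)^(1/2)`. -/
abbrev L2Pair {d : ℕ} (Ω : Set (EuclideanSpace ℝ (Fin d))) : Type :=
  WithLp 2 (L2 Ω × Lp (EuclideanSpace ℝ (Fin d)) 2 (volume.restrict Ω))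

/-- The pairs `(φ, ∇φ)` with `φ ∈ C_c^∞(Ω)`. -/
def testPairs {d : ℕ} (Ω : Set (EuclideanSpace ℝ (Fin d))) : Set (L2Pair Ω) :=
  {w | ∃ φ : EuclideanSpace ℝ (Fin d) → ℝ, ContDiff ℝ ∞ φ ∧ HasCompactSupport φ ∧
    tsupport φ ⊆ Ω ∧ w.fst =ᵐ[volume.restrict Ω] φ ∧ w.snd =ᵐ[volume.restrict Ω] gradient φ}

/-- The Sobolev space `H₀¹(Ω)`: the closure of `C_c^∞(Ω)` in the norm
`‖v‖² = ‖v‖²_{L²(Ω)} + ‖∇v‖²_{L²(Ω)}`. An element is stored with its weak gradient.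
(`testPairs Ω` is already closed under linear combinations, so the span adds nothing.) -/
abbrev H01 {d : ℕ} (Ω : Set (EuclideanSpace ℝ (Fin d))) : Type :=
  (Submodule.span ℝ (testPairs Ω)).topologicalClosure

/-- The `L²(Ω)` function underlying an element of `H₀¹(Ω)`. -/
def H01.fn {d : ℕ} {Ω : Set (EuclideanSpace ℝ (Fin d))} (v : H01 Ω) : L2 Ω := v.1.fst

/-- The weak gradient of an element of `H₀¹(Ω)`. -/
def H01.grad {d : ℕ} {Ω : Set (EuclideanSpace ℝ (Fin d))} (v : H01 Ω) :
    Lp (EuclideanSpace ℝ (Fin d)) 2 (volume.restrict Ω) := v.1.snd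

/-- `A ∇v · ∇w` at the point `x`, for the coefficient matrix `A = (a i j)`. -/
def flux {d : ℕ} {Ω : Set (EuclideanSpace ℝ (Fin d))}
    (a : Fin d → Fin d → EuclideanSpace ℝ (Fin d) → ℝ) (v w : H01 Ω)
    (x : EuclideanSpace ℝ (Fin d)) : ℝ :=
  ∑ i, ∑ j, a i j x * v.grad x j * w.grad x i

/-- The weak form `⟨𝒜 v, w⟩ = ∫_Ω A ∇v · ∇w + a₀ v w` of the operator
`𝒜 v = -∇ · (A ∇v) + a₀ v` on `H₀¹(Ω)`. -/
def ellipticForm {d : ℕ} (Ω : Set (EuclideanSpace ℝ (Fin d)))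
    (a : Fin d → Fin d → EuclideanSpace ℝ (Fin d) → ℝ) (a₀ : EuclideanSpace ℝ (Fin d) → ℝ)
    (v w : H01 Ω) : ℝ :=
  ∫ x in Ω, (flux a v w x + a₀ x * v.fn x * w.fn x)

/-- Lebesgue measure on the time interval `(0, T]`. -/
abbrev timeMeasure (T : ℝ) : Measure ℝ := volume.restrict (Ioc 0 T)

/-- The space `P = {v ∈ H¹(0,T; H₀¹(Ω)) | v(T) = 0}`. An element is given by its absolutely
continuous representative `val` on `[0,T]` and its time derivative `dt ∈ L²(0,T; H₀¹(Ω))`. -/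
structure SpaceP {d : ℕ} (Ω : Set (EuclideanSpace ℝ (Fin d))) (T : ℝ) where
  val : ℝ → H01 Ω
  dt : ℝ → H01 Ω
  memLp_dt : MemLp dt 2 (timeMeasure T)
  val_eq : ∀ t ∈ Icc 0 T, val t = val 0 + ∫ s in (0 : ℝ)..t, dt s
  val_end : val T = 0

/-- The space `Q = L²(0,T; H₀¹(Ω))`. -/
abbrev SpaceQ {d : ℕ} (Ω : Set (EuclideanSpace ℝ (Fin d))) (T : ℝ) : Type :=
  Lp (H01 Ω) 2 (timeMeasure T)

/-- The space `L²(0,T; H⁻¹(Ω))`, where `H⁻¹(Ω)` is the dual of `H₀¹(Ω)`. -/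
abbrev SourceSpace {d : ℕ} (Ω : Set (EuclideanSpace ℝ (Fin d))) (T : ℝ) : Type :=
  Lp (StrongDual ℝ (H01 Ω)) 2 (timeMeasure T)

theorem SpaceP.intervalIntegrable_dt {d : ℕ} {Ω : Set (EuclideanSpace ℝ (Fin d))} {T : ℝ}
    (v : SpaceP Ω T) {t : ℝ} (ht : t ∈ Icc 0 T) : IntervalIntegrable v.dt volume 0 t := by
  rw [intervalIntegrable_iff_integrableOn_Ioc_of_le ht.1]
  have h : IntegrableOn v.dt (Ioc 0 T) volume :=
    v.memLp_dt.integrable (by norm_num)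
  exact h.mono_set (Ioc_subset_Ioc_right ht.2)

/-- The difference of two elements of `P`. -/
instance {d : ℕ} {Ω : Set (EuclideanSpace ℝ (Fin d))} {T : ℝ} : Sub (SpaceP Ω T) where
  sub v w :=
    { val := fun t => v.val t - w.val t
      dt := fun t => v.dt t - w.dt t
      memLp_dt := v.memLp_dt.sub w.memLp_dt
      val_eq := fun t ht => by
        rw [v.val_eq t ht, w.val_eq t ht,
          intervalIntegral.integral_sub (v.intervalIntegrable_dt ht) (w.intervalIntegrable_dt ht)]
        abel
      val_end := by rw [v.val_end, w.val_end, sub_zero] }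

/-- A time grid `0 = τ₀ < τ₁ < ⋯ < τ_N = T`. -/
structure IsTimeGrid (T : ℝ) {N : ℕ} (τ : Fin (N + 1) → ℝ) : Prop where
  strictMono : StrictMono τ
  first : τ 0 = 0
  last : τ (Fin.last N) = T

/-- Membership in `P^k`: on every interval `I_i = (τ_{i-1}, τ_i]` the function is a polynomial of
degree at most one in time. -/
def SpaceP.IsPiecewiseLinear {d : ℕ} {Ω : Set (EuclideanSpace ℝ (Fin d))} {T : ℝ}
    (v : SpaceP Ω T) {N : ℕ} (τ : Fin (N + 1) → ℝ) : Prop :=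
  ∀ i : Fin N, ∃ b c : H01 Ω, ∀ t ∈ Ioc (τ i.castSucc) (τ i.succ), v.val t = b + t • c

/-- The bilinear form `B_M((v₁, v₂), (w₁, w₂))` of the mixed formulation. -/
def mixedForm {d : ℕ} (Ω : Set (EuclideanSpace ℝ (Fin d))) (T : ℝ)
    (a : Fin d → Fin d → EuclideanSpace ℝ (Fin d) → ℝ) (a₀ : EuclideanSpace ℝ (Fin d) → ℝ) (α : ℝ)
    (v₁ : SpaceP Ω T) (v₂ : SpaceQ Ω T) (w₁ : SpaceP Ω T) (w₂ : SpaceQ Ω T) : ℝ :=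
  (∫ t in (0 : ℝ)..T, ∫ x in Ω,
    ((v₁.dt t).fn x * (w₁.dt t).fn x + (v₂ t).fn x * (w₂ t).fn x
      + a₀ x * ((v₂ t).fn x * (w₁.val t).fn x - (v₁.val t).fn x * (w₂ t).fn x)))
  + (∫ t in (0 : ℝ)..T, ∫ x in Ω,
      (flux a (v₂ t) (w₁.val t) x - flux a (v₁.val t) (w₂ t) x))
  + ∫ x in Ω, (flux a (v₁.val 0) (w₁.val 0) x
      + (a₀ x + 1 / α) * (v₁.val 0).fn x * (w₁.val 0).fn x)

/-- The linear form `L_M(w₁, w₂) = ∫_{Ω_T} f̃ w₁`, read as the duality pairing of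
`L²(0,T; H⁻¹(Ω))` and `L²(0,T; H₀¹(Ω))`. -/
def mixedLoad {d : ℕ} {Ω : Set (EuclideanSpace ℝ (Fin d))} {T : ℝ} (f : SourceSpace Ω T)
    (w₁ : SpaceP Ω T) : ℝ :=
  ∫ t in (0 : ℝ)..T, f t (w₁.val t)

/-- `(p, q) ∈ P × Q` solves the mixed weak formulation. -/
def IsMixedSolution {d : ℕ} (Ω : Set (EuclideanSpace ℝ (Fin d))) (T : ℝ)
    (a : Fin d → Fin d → EuclideanSpace ℝ (Fin d) → ℝ) (a₀ : EuclideanSpace ℝ (Fin d) → ℝ) (α : ℝ)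
    (f : SourceSpace Ω T) (p : SpaceP Ω T) (q : SpaceQ Ω T) : Prop :=
  ∀ (w₁ : SpaceP Ω T) (w₂ : SpaceQ Ω T), mixedForm Ω T a a₀ α p q w₁ w₂ = mixedLoad f w₁

/-- `(p, q) ∈ P^k × Q` solves the semi-time discrete mixed weak formulation. -/
def IsSemiDiscreteSolution {d : ℕ} (Ω : Set (EuclideanSpace ℝ (Fin d))) (T : ℝ)
    (a : Fin d → Fin d → EuclideanSpace ℝ (Fin d) → ℝ) (a₀ : EuclideanSpace ℝ (Fin d) → ℝ) (α : ℝ)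
    (f : SourceSpace Ω T) {N : ℕ} (τ : Fin (N + 1) → ℝ) (p : SpaceP Ω T) (q : SpaceQ Ω T) : Prop :=
  p.IsPiecewiseLinear τ ∧
    ∀ (w₁ : SpaceP Ω T) (w₂ : SpaceQ Ω T), w₁.IsPiecewiseLinear τ →
      mixedForm Ω T a a₀ α p q w₁ w₂ = mixedLoad f w₁

/-- The norm `‖(v₁, v₂)‖_M = (∫_{Ω_T} (∂ₜ v₁)² + v₂²)^(1/2)` on `P × Q`. -/
def normM {d : ℕ} {Ω : Set (EuclideanSpace ℝ (Fin d))} {T : ℝ} (v₁ : SpaceP Ω T)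
    (v₂ : SpaceQ Ω T) : ℝ :=
  Real.sqrt (∫ t in (0 : ℝ)..T, ∫ x in Ω, (((v₁.dt t).fn x) ^ 2 + ((v₂ t).fn x) ^ 2))

/-- `r` is the residual `f̃ + p_tt - 𝒜 q`: for almost every time `t` the element
`f̃(t) + p_tt(t) - 𝒜 q(t)` of `H⁻¹(Ω)` is the function `r(t) ∈ L²(Ω)`. For `p ∈ P^k` almost every
`t` is interior to some `I_i`, so that `p_tt(t)` is the derivative taken interval by interval. -/
def IsResidual {d : ℕ} (Ω : Set (EuclideanSpace ℝ (Fin d))) (T : ℝ)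
    (a : Fin d → Fin d → EuclideanSpace ℝ (Fin d) → ℝ) (a₀ : EuclideanSpace ℝ (Fin d) → ℝ)
    (f : SourceSpace Ω T) (p : SpaceP Ω T) (q : SpaceQ Ω T) (r : ℝ → L2 Ω) : Prop :=
  AEStronglyMeasurable r (timeMeasure T) ∧
    ∀ᵐ t ∂(timeMeasure T), ∀ φ : H01 Ω,
      ∫ x in Ω, r t x * φ.fn x =
        f t φ + (∫ x in Ω, (iteratedDeriv 2 p.val t).fn x * φ.fn x) - ellipticForm Ω a a₀ (q t) φ

/-- The estimator `η² = ∑ᵢ ∫_{I_i} ∫_Ω (Δτᵢ)² (f̃ + p_tt - 𝒜 q)²` in `[0, ∞]`. The residual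
function is unique almost everywhere, so the infimum is the value of the sum at it; the value is
`∞` if the residual is not a function with values in `L²(Ω)`. -/
def etaSq {d : ℕ} (Ω : Set (EuclideanSpace ℝ (Fin d))) (T : ℝ)
    (a : Fin d → Fin d → EuclideanSpace ℝ (Fin d) → ℝ) (a₀ : EuclideanSpace ℝ (Fin d) → ℝ)
    (f : SourceSpace Ω T) {N : ℕ} (τ : Fin (N + 1) → ℝ) (p : SpaceP Ω T) (q : SpaceQ Ω T) :
    ℝ≥0∞ :=
  ⨅ (r : ℝ → L2 Ω) (_ : IsResidual Ω T a a₀ f p q r),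
    ∑ i : Fin N, ∫⁻ t in Ioc (τ i.castSucc) (τ i.succ), ∫⁻ x in Ω,
      ENNReal.ofReal ((τ i.succ - τ i.castSucc) ^ 2 * (r t x) ^ 2)

end MixedEvolution

end

noncomputable section

namespace MixedEvolution

/-! ### The time grid: splitting integrals and almost-everywhere statements over its intervals -/

section Grid

variable {T : ℝ} {N : ℕ} {τ : Fin (N + 1) → ℝ}

/-! The estimate is an energy argument combined with Galerkin orthogonality. Let `e` and `E` be the
errors in the two components. Tested with `(e, E)` itself, the mixed form loses its cross terms by
symmetry of the elliptic form, and what remains is the squared mixed norm plus an initial term that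
is nonnegative by coercivity and `α > 0`.

By the two equations this energy is at most the load of `e` minus the discrete solution's form
tested with `(e, E)`. Let `u` be the nodal piecewise linear interpolant of `e`; only time is
discretised, so `(u, E)` is an admissible discrete test pair and the second test component can be
removed entirely. What is left is the residual tested with `w = e - u`. Since `w` vanishes at every
node, the initial term drops out, and the time-derivative term vanishes because the discrete
derivative is constant on each interval. Hence the energy is at most `∫ (ρ, w)`, with `ρ` the
`L²(Ω)` residual.

On an interval of length `δ`, `‖w(t)‖² ≤ δ ∫ ‖e'‖²` in `L²(Ω)`. Young's inequality with weights `δ`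
and `δ⁻¹` bounds `∫ (ρ, w)` by half the estimator plus half of `∫ ‖e'‖²`, which the energy absorbs;
the constant is therefore 1.

The argument uses only a symmetric nonnegative bounded form on a space `V` and a bounded map `J : V
→ H`. It is carried out at that level in `abstract_error_estimate`, resting on
`IsPath.exists_interpolant`, `IsPath.norm_interpolation_error_sq_le` and
`IsPath.integral_massForm_eq_zero`. The concrete forms are then identified with the abstract ones.
-/

theorem IsTimeGrid.mem_Icc (h : IsTimeGrid T τ) (i : Fin (N + 1)) : τ i ∈ Icc 0 T :=
  ⟨h.first ▸ h.strictMono.monotone (Fin.zero_le i),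
    h.last ▸ h.strictMono.monotone (Fin.le_last i)⟩

theorem IsTimeGrid.lt (h : IsTimeGrid T τ) (i : Fin N) : τ i.castSucc < τ i.succ :=
  h.strictMono i.castSucc_lt_succ

theorem IsTimeGrid.Ioc_subset (h : IsTimeGrid T τ) (i : Fin N) :
    Ioc (τ i.castSucc) (τ i.succ) ⊆ Ioc 0 T :=
  Ioc_subset_Ioc (h.mem_Icc _).1 (h.mem_Icc _).2

theorem IsTimeGrid.Icc_subset (h : IsTimeGrid T τ) (i : Fin N) :
    Icc (τ i.castSucc) (τ i.succ) ⊆ Icc 0 T :=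
  Icc_subset_Icc (h.mem_Icc _).1 (h.mem_Icc _).2

theorem IsTimeGrid.eq_of_mem (h : IsTimeGrid T τ) {i j : Fin N} {t : ℝ}
    (hi : t ∈ Ioc (τ i.castSucc) (τ i.succ)) (hj : t ∈ Ioc (τ j.castSucc) (τ j.succ)) :
    i = j := by
  have key : ∀ k l : Fin N, k < l → τ k.succ ≤ τ l.castSucc := fun k l hkl =>
    h.strictMono.monotone (Fin.succ_le_castSucc_iff.2 hkl)
  rcases lt_trichotomy i j with hij | hij | hij
  · exact absurd (hi.2.trans (key i j hij)) (not_le.2 hj.1)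
  · exact hij
  · exact absurd (hj.2.trans (key j i hij)) (not_le.2 hi.1)

theorem IsTimeGrid.intervalIntegrable {E : Type*} [NormedAddCommGroup E] (h : IsTimeGrid T τ)
    {g : ℝ → E} (hg : IntervalIntegrable g volume 0 T) (i : Fin N) :
    IntervalIntegrable g volume (τ i.castSucc) (τ i.succ) := by
  have hT : (0 : ℝ) ≤ T := (h.mem_Icc 0).1.trans (h.mem_Icc 0).2
  refine hg.mono_set ?_
  rw [uIcc_of_le hT, uIcc_of_le (h.lt i).le]
  exact h.Icc_subset i

/-- Arbitrary end points are allowed because the induction discards the last interval. Integrability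
on the whole range is carried along, since gluing adjacent integrals requires it. -/
theorem sum_integral_grid {N : ℕ} (τ : Fin (N + 1) → ℝ) {g : ℝ → ℝ}
    (hg : ∀ i : Fin N, IntervalIntegrable g volume (τ i.castSucc) (τ i.succ)) :
    IntervalIntegrable g volume (τ 0) (τ (Fin.last N)) ∧
    ∑ i : Fin N, ∫ t in (τ i.castSucc)..(τ i.succ), g t = ∫ t in (τ 0)..(τ (Fin.last N)), g t := by
  induction N with
  | zero => simp
  | succ n ih =>
    obtain ⟨h1, h2⟩ := ih (fun i => τ i.castSucc) fun i => hg i.castSucc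
    have h3 := hg (Fin.last n)
    rw [Fin.sum_univ_castSucc]
    refine ⟨h1.trans h3, ?_⟩
    exact (congrArg₂ (· + ·) h2 rfl).trans (intervalIntegral.integral_add_adjacent_intervals h1 h3)

theorem IsTimeGrid.sum_integral (h : IsTimeGrid T τ) {g : ℝ → ℝ}
    (hg : ∀ i : Fin N, IntervalIntegrable g volume (τ i.castSucc) (τ i.succ)) :
    ∑ i : Fin N, ∫ t in (τ i.castSucc)..(τ i.succ), g t = ∫ t in (0 : ℝ)..T, g t := by
  rw [(sum_integral_grid τ hg).2, h.first, h.last]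

/-- The grid intervals are disjoint, so only the `i`-th indicator is nonzero between the left node
and `t`. -/
theorem IsTimeGrid.integral_sum_indicator {E : Type*} [NormedAddCommGroup E] [NormedSpace ℝ E]
    [CompleteSpace E] (h : IsTimeGrid T τ) (c : Fin N → E) (i : Fin N) {t : ℝ}
    (ht : t ∈ Icc (τ i.castSucc) (τ i.succ)) :
    ∫ s in (τ i.castSucc)..t,
      ∑ j, (Ioc (τ j.castSucc) (τ j.succ)).indicator (fun _ => c j) s =
        (t - τ i.castSucc) • c i := by
  rw [intervalIntegral.integral_congr_ae (g := fun _ => c i), intervalIntegral.integral_const]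
  refine Filter.Eventually.of_forall fun s hs => ?_
  rw [uIoc_of_le ht.1] at hs
  have hs' : s ∈ Ioc (τ i.castSucc) (τ i.succ) := ⟨hs.1, hs.2.trans ht.2⟩
  rw [Finset.sum_eq_single i, indicator_of_mem hs']
  · intro j _ hj
    exact indicator_of_notMem (fun hm => hj (h.eq_of_mem hm hs')) _
  · simp

end Grid

/-! ### Absolutely continuous paths and their nodal interpolants -/

section Path

variable {V : Type*} [NormedAddCommGroup V] [NormedSpace ℝ V]

/-- `v` is absolutely continuous on `[0, T]` with derivative `v' ∈ L²(0, T; V)` and `v(T) = 0`. -/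
structure IsPath (T : ℝ) (v v' : ℝ → V) : Prop where
  memLp : MemLp v' 2 (timeMeasure T)
  eq : ∀ t ∈ Icc 0 T, v t = v 0 + ∫ s in (0 : ℝ)..t, v' s
  vanish : v T = 0

/-- `v` is affine in time on each interval of the grid. -/
def IsGridAffine {N : ℕ} (τ : Fin (N + 1) → ℝ) (v : ℝ → V) : Prop :=
  ∀ i : Fin N, ∃ b c : V, ∀ t ∈ Ioc (τ i.castSucc) (τ i.succ), v t = b + t • c

variable {T : ℝ} {v v' w w' : ℝ → V}

theorem IsPath.intervalIntegrable (h : IsPath T v v') (hT : 0 ≤ T) :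
    IntervalIntegrable v' volume 0 T := by
  rw [intervalIntegrable_iff_integrableOn_Ioc_of_le hT]
  exact MemLp.integrable (by norm_num) h.memLp

theorem IsPath.intervalIntegrable_of_mem (h : IsPath T v v') {s t : ℝ}
    (hs : s ∈ Icc 0 T) (ht : t ∈ Icc 0 T) : IntervalIntegrable v' volume s t := by
  have hT : 0 ≤ T := hs.1.trans hs.2
  refine (h.intervalIntegrable hT).mono_set ?_
  rw [uIcc_of_le hT]
  exact uIcc_subset_Icc hs ht

theorem IsPath.integral_eq_sub (h : IsPath T v v') {s t : ℝ} (hs : s ∈ Icc 0 T)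
    (ht : t ∈ Icc 0 T) : ∫ x in s..t, v' x = v t - v s := by
  have h0 : (0 : ℝ) ∈ Icc 0 T := ⟨le_rfl, hs.1.trans hs.2⟩
  rw [h.eq t ht, h.eq s hs, ← intervalIntegral.integral_add_adjacent_intervals
    (h.intervalIntegrable_of_mem h0 hs) (h.intervalIntegrable_of_mem hs ht)]
  abel

theorem IsPath.sub (h : IsPath T v v') (k : IsPath T w w') :
    IsPath T (fun t => v t - w t) (fun t => v' t - w' t) where
  memLp := h.memLp.sub k.memLp
  eq t ht := by
    have h0 : (0 : ℝ) ∈ Icc 0 T := ⟨le_rfl, ht.1.trans ht.2⟩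
    rw [h.eq t ht, k.eq t ht, intervalIntegral.integral_sub (h.intervalIntegrable_of_mem h0 ht)
      (k.intervalIntegrable_of_mem h0 ht)]
    abel
  vanish := by rw [h.vanish, k.vanish, sub_zero]

theorem IsPath.continuousOn (h : IsPath T v v') (hT : 0 ≤ T) : ContinuousOn v (Icc 0 T) := by
  have h1 := intervalIntegral.continuousOn_primitive_interval' (h.intervalIntegrable hT)
    (left_mem_uIcc)
  rw [uIcc_of_le hT] at h1
  exact (continuousOn_const.add h1).congr h.eq

theorem IsPath.memLp_val (h : IsPath T v v') (hT : 0 ≤ T) : MemLp v 2 (timeMeasure T) := by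
  have hc := h.continuousOn hT
  obtain ⟨C, hC⟩ := isCompact_Icc.exists_bound_of_continuousOn hc
  refine MemLp.of_bound ((hc.mono Ioc_subset_Icc_self).aestronglyMeasurable measurableSet_Ioc) C ?_
  exact (ae_restrict_mem measurableSet_Ioc).mono fun t ht => hC t (Ioc_subset_Icc_self ht)

variable {N : ℕ} {τ : Fin (N + 1) → ℝ}

variable [CompleteSpace V]

/-- The derivative of a grid affine path is almost everywhere constant on each interval. -/
theorem IsPath.ae_eq_const (h : IsPath T v v') (hτ : IsTimeGrid T τ) (hv : IsGridAffine τ v)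
    (i : Fin N) :
    ∃ c : V, ∀ᵐ t, t ∈ Ioc (τ i.castSucc) (τ i.succ) → v' t = c := by
  obtain ⟨b, c, hbc⟩ := hv i
  have hT : (0 : ℝ) ≤ T := (hτ.mem_Icc 0).1.trans (hτ.mem_Icc 0).2
  refine ⟨c, ?_⟩
  have hne : ∀ᵐ t : ℝ, t ≠ τ i.succ := by simp [ae_iff, measure_singleton]
  -- Lebesgue differentiation gives the primitive the derivative `v' t` at almost every `t`. Near an
  -- interior point the path is also affine with slope `c`, so uniqueness of derivatives applies.
  -- The right node is excluded because the affine formula says nothing beyond it.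
  filter_upwards [(h.intervalIntegrable hT).ae_hasDerivAt_integral, hne] with t ht h2 hmem
  have hmT := Ioc_subset_Icc_self (hτ.Ioc_subset i hmem)
  rw [uIcc_of_le hT] at ht
  have h3 := (ht hmT 0 ⟨le_rfl, hT⟩).const_add (v 0)
  have h4 : HasDerivAt (fun s : ℝ => b + s • c) c t := by
    simpa using ((hasDerivAt_id t).smul_const c).const_add b
  refine h3.unique (h4.congr_of_eventuallyEq ?_)
  filter_upwards [Ioo_mem_nhds hmem.1 (lt_of_le_of_ne hmem.2 h2)] with s hs
  rw [← hbc s (Ioo_subset_Ioc_self hs),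
    h.eq s (Ioc_subset_Icc_self (hτ.Ioc_subset i (Ioo_subset_Ioc_self hs)))]

/-- Every path has a nodal interpolant that is affine on each interval of the grid. -/
theorem IsPath.exists_interpolant (h : IsPath T v v') (hτ : IsTimeGrid T τ) :
    ∃ u u' : ℝ → V, IsPath T u u' ∧ IsGridAffine τ u ∧ (∀ i, u (τ i) = v (τ i)) ∧
      ∀ i : Fin N, ∀ t ∈ Icc (τ i.castSucc) (τ i.succ), u t = v (τ i.castSucc) +
        ((t - τ i.castSucc) / (τ i.succ - τ i.castSucc)) • (v (τ i.succ) - v (τ i.castSucc)) := by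
  -- The interpolant is the primitive, started at `v 0`, of the step function of difference
  -- quotients. This makes it a path by construction, and agreement at the nodes follows by
  -- induction.
  set c : Fin N → V := fun i =>
    (τ i.succ - τ i.castSucc)⁻¹ • (v (τ i.succ) - v (τ i.castSucc)) with hc
  set u' : ℝ → V := fun t =>
    ∑ j, (Ioc (τ j.castSucc) (τ j.succ)).indicator (fun _ => c j) t with hu'
  set u : ℝ → V := fun t => v 0 + ∫ s in (0 : ℝ)..t, u' s with hu
  have hint : Integrable u' := integrable_finsetSum _ fun j _ =>
    (integrable_indicator_iff measurableSet_Ioc).2 (integrableOn_const (by simp))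
  have hu0 : u 0 = v 0 := by simp [hu]
  have hsub : ∀ s t, u t = u s + ∫ x in s..t, u' x := by
    intro s t
    simp only [hu]
    rw [add_assoc, intervalIntegral.integral_add_adjacent_intervals
      hint.intervalIntegrable hint.intervalIntegrable]
  have hstep : ∀ i : Fin N, ∀ t ∈ Icc (τ i.castSucc) (τ i.succ),
      u t = u (τ i.castSucc) + (t - τ i.castSucc) • c i := fun i t ht => by
    rw [hsub (τ i.castSucc) t, hτ.integral_sum_indicator c i ht]
  have hnode : ∀ i, u (τ i) = v (τ i) := by
    intro i
    induction i using Fin.induction with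
    | zero => rw [hτ.first, hu0]
    | succ i ih =>
      have hne : τ i.succ - τ i.castSucc ≠ 0 := (sub_pos.2 (hτ.lt i)).ne'
      rw [hstep i _ (right_mem_Icc.2 (hτ.lt i).le), ih, hc]
      simp only [smul_smul, mul_inv_cancel₀ hne, one_smul]
      abel
  refine ⟨u, u', ⟨?_, fun t _ => by rw [hu0], ?_⟩, ?_, hnode, ?_⟩
  · exact memLp_finsetSum _ fun j _ => (memLp_indicator_const 2 measurableSet_Ioc (c j)
      (Or.inr (by simp))).restrict _
  · rw [← hτ.last, hnode, hτ.last, h.vanish]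
  · intro i
    refine ⟨u (τ i.castSucc) - τ i.castSucc • c i, c i, fun t ht => ?_⟩
    rw [hstep i t (Ioc_subset_Icc_self ht), sub_smul]
    abel
  · intro i t ht
    rw [hstep i t ht, hnode, hc, div_eq_mul_inv]
    simp only [smul_smul]

end Path

/-! ### Cauchy–Schwarz in time -/

section Analysis

/-- Cauchy–Schwarz against the constant 1: expand `0 ≤ ∫ ((b - a) g - A)²`, with `A` the integral of
`g`, and divide by `b - a`. -/
theorem sq_integral_le {g : ℝ → ℝ} {a b : ℝ} (hab : a < b)
    (hg : IntervalIntegrable g volume a b) (hg2 : IntervalIntegrable (fun t => g t ^ 2) volume a b) :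
    (∫ t in a..b, g t) ^ 2 ≤ (b - a) * ∫ t in a..b, g t ^ 2 := by
  set A := ∫ t in a..b, g t with hA
  have hpos : 0 < b - a := sub_pos.2 hab
  have h1 : 0 ≤ ∫ t in a..b, ((b - a) * g t - A) ^ 2 :=
    intervalIntegral.integral_nonneg hab.le fun t _ => sq_nonneg _
  have h2 : ∫ t in a..b, ((b - a) * g t - A) ^ 2 =
      (b - a) ^ 2 * (∫ t in a..b, g t ^ 2) - 2 * (b - a) * A * A + (b - a) * A ^ 2 := by
    have e : ∀ t, ((b - a) * g t - A) ^ 2 =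
        ((b - a) ^ 2 * g t ^ 2 - 2 * (b - a) * A * g t) + A ^ 2 := fun t => by ring
    simp only [e]
    rw [intervalIntegral.integral_add ((hg2.const_mul _).sub (hg.const_mul _)) (by simp),
      intervalIntegral.integral_sub (hg2.const_mul _) (hg.const_mul _),
      intervalIntegral.integral_const_mul, intervalIntegral.integral_const_mul,
      intervalIntegral.integral_const, ← hA, smul_eq_mul]
  rw [h2] at h1
  have h3 : 0 ≤ (b - a) * ((b - a) * (∫ t in a..b, g t ^ 2) - A ^ 2) := by nlinarith
  have := nonneg_of_mul_nonneg_right h3 hpos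
  linarith

end Analysis

/-! ### The abstract mixed form and the error estimate -/

section Estimate

variable {V H : Type*} [NormedAddCommGroup V] [NormedSpace ℝ V]
  [NormedAddCommGroup H] [InnerProductSpace ℝ H] {T : ℝ} {N : ℕ} {τ : Fin (N + 1) → ℝ}

/-- The interpolation error of the linear interpolant on one interval. -/
theorem IsPath.norm_interpolation_error_sq_le [CompleteSpace V] [CompleteSpace H] {v v' : ℝ → V}
    (h : IsPath T v v') (J : V →L[ℝ] H) {a b t : ℝ} (hab : a < b) (ha : a ∈ Icc 0 T)
    (hb : b ∈ Icc 0 T) (ht : t ∈ Icc a b) :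
    ‖J (v t - (v a + ((t - a) / (b - a)) • (v b - v a)))‖ ^ 2 ≤
      (b - a) * ∫ s in a..b, ‖J (v' s)‖ ^ 2 := by
  have htT : t ∈ Icc 0 T := ⟨ha.1.trans ht.1, ht.2.trans hb.2⟩
  have hsub : Ioc a b ⊆ Ioc 0 T := Ioc_subset_Ioc ha.1 hb.2
  have hJ : MemLp (fun s => J (v' s)) 2 (timeMeasure T) := J.comp_memLp' h.memLp
  have hJ' : MemLp (fun s => J (v' s)) 2 (volume.restrict (Ioc a b)) :=
    hJ.mono_measure (Measure.restrict_mono hsub le_rfl)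
  have hn : IntervalIntegrable (fun s => ‖J (v' s)‖) volume a b := by
    rw [intervalIntegrable_iff_integrableOn_Ioc_of_le hab.le]
    exact (MemLp.integrable (by norm_num) hJ').norm
  have hn2 : IntervalIntegrable (fun s => ‖J (v' s)‖ ^ 2) volume a b := by
    rw [intervalIntegrable_iff_integrableOn_Ioc_of_le hab.le]
    exact hJ'.integrable_norm_pow (by norm_num)
  have bound : ∀ x y, a ≤ x → x ≤ y → y ≤ b →
      ‖J (v y - v x)‖ ≤ ∫ s in a..b, ‖J (v' s)‖ := by
    intro x y hx hxy hy
    have hxT : x ∈ Icc 0 T := ⟨ha.1.trans hx, (hxy.trans hy).trans hb.2⟩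
    have hyT : y ∈ Icc 0 T := ⟨hxT.1.trans hxy, hy.trans hb.2⟩
    rw [← h.integral_eq_sub hxT hyT,
      ← J.intervalIntegral_comp_comm (h.intervalIntegrable_of_mem hxT hyT)]
    refine (intervalIntegral.norm_integral_le_integral_norm hxy).trans ?_
    exact intervalIntegral.integral_mono_interval hx hxy hy
      (Filter.Eventually.of_forall fun _ => norm_nonneg _) hn
  set A := ∫ s in a..b, ‖J (v' s)‖ with hA
  have hba : 0 < b - a := sub_pos.2 hab
  set σ := (t - a) / (b - a) with hσ
  have hσ0 : 0 ≤ σ := div_nonneg (sub_nonneg.2 ht.1) hba.le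
  have hσ1 : σ ≤ 1 := (div_le_one hba).2 (by linarith [ht.2])
  -- The error is a difference of two increments of `v` with weights `1 - σ` and `σ`. Each increment
  -- is at most `A` after applying `J` and the weights sum to 1, so no constant is lost.
  have hsplit : v t - (v a + σ • (v b - v a)) = (1 - σ) • (v t - v a) - σ • (v b - v t) := by
    module
  have h1 : ‖J (v t - (v a + σ • (v b - v a)))‖ ≤ A := by
    rw [hsplit, map_sub, map_smul, map_smul]
    refine (norm_sub_le _ _).trans ?_
    rw [norm_smul, norm_smul, Real.norm_of_nonneg hσ0, Real.norm_of_nonneg (sub_nonneg.2 hσ1)]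
    have e1 := mul_le_mul_of_nonneg_left (bound a t le_rfl ht.1 ht.2) (sub_nonneg.2 hσ1)
    have e2 := mul_le_mul_of_nonneg_left (bound t b ht.1 ht.2 le_rfl) hσ0
    linarith
  exact (pow_le_pow_left₀ (norm_nonneg _) h1 2).trans (sq_integral_le hab hn hn2)

theorem intervalIntegrable_bilin {E F : Type*} [NormedAddCommGroup E] [NormedSpace ℝ E]
    [NormedAddCommGroup F] [NormedSpace ℝ F] (hT : 0 ≤ T) (B : E →L[ℝ] F →L[ℝ] ℝ) {v : ℝ → E}
    {w : ℝ → F} (hv : MemLp v 2 (timeMeasure T)) (hw : MemLp w 2 (timeMeasure T)) :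
    IntervalIntegrable (fun t => B (v t) (w t)) volume 0 T := by
  rw [intervalIntegrable_iff_integrableOn_Ioc_of_le hT]
  exact memLp_one_iff_integrable.1 (B.memLp_of_bilin 1 hv hw)

theorem intervalIntegrable_apply (hT : 0 ≤ T) {f : ℝ → StrongDual ℝ V} {w : ℝ → V}
    (hf : MemLp f 2 (timeMeasure T)) (hw : MemLp w 2 (timeMeasure T)) :
    IntervalIntegrable (fun t => f t (w t)) volume 0 T :=
  intervalIntegrable_bilin hT (ContinuousLinearMap.id ℝ (StrongDual ℝ V)) hf hw

/-- The form `(v, w) ↦ (J v, J w)` on `V`. -/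
def massForm (J : V →L[ℝ] H) : V →L[ℝ] V →L[ℝ] ℝ := (innerSL ℝ).bilinearComp J J

theorem massForm_apply (J : V →L[ℝ] H) (v w : V) : massForm J v w = inner ℝ (J v) (J w) := rfl

/-- The time integrand of the mixed form, for a form `B` on `V` and an embedding `J : V → H`. -/
def mixedIntegrand (J : V →L[ℝ] H) (B : V →L[ℝ] V →L[ℝ] ℝ) (v v' q w w' r : V) : ℝ :=
  massForm J v' w' + massForm J q r + (B q w - B v r)

/-- The mixed form for a form `B` on `V` and an embedding `J : V → H`. -/
def abstractMixedForm (T : ℝ) (J : V →L[ℝ] H) (B : V →L[ℝ] V →L[ℝ] ℝ) (β : ℝ)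
    (v v' q w w' r : ℝ → V) : ℝ :=
  (∫ t in (0 : ℝ)..T, mixedIntegrand J B (v t) (v' t) (q t) (w t) (w' t) (r t)) +
    (B (v 0) (w 0) + β * massForm J (v 0) (w 0))

variable {J : V →L[ℝ] H} {B : V →L[ℝ] V →L[ℝ] ℝ} {β : ℝ} {v v' q w w' r u u' s : ℝ → V}

theorem intervalIntegrable_mixedIntegrand (hT : 0 ≤ T)
    (J : V →L[ℝ] H) (B : V →L[ℝ] V →L[ℝ] ℝ) (hv : IsPath T v v')
    (hq : MemLp q 2 (timeMeasure T)) (hw : IsPath T w w') (hr : MemLp r 2 (timeMeasure T)) :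
    IntervalIntegrable (fun t => mixedIntegrand J B (v t) (v' t) (q t) (w t) (w' t) (r t))
      volume 0 T :=
  ((intervalIntegrable_bilin hT _ hv.memLp hw.memLp).add
    (intervalIntegrable_bilin hT _ hq hr)).add
    ((intervalIntegrable_bilin hT _ hq (hw.memLp_val hT)).sub
    (intervalIntegrable_bilin hT _ (hv.memLp_val hT) hr))

theorem form_add_apply (K Z : V →L[ℝ] V →L[ℝ] ℝ) (x y : V) : (K + Z) x y = K x y + Z x y := rfl

/-- The concrete form keeps mass and zeroth order terms (`Z`) in one time integral and gradient
terms (`K`) in another. Merging them needs both to be integrable, which holds because each term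
pairs two functions that are `L²` in time. -/
theorem abstractMixedForm_eq_of_split (hT : 0 ≤ T) {K Z : V →L[ℝ] V →L[ℝ] ℝ}
    (hv : IsPath T v v') (hq : MemLp q 2 (timeMeasure T)) (hw : IsPath T w w')
    (hr : MemLp r 2 (timeMeasure T)) {X Y : ℝ → ℝ} {x₀ : ℝ}
    (hX : ∀ t, X t = inner ℝ (J (v' t)) (J (w' t)) + inner ℝ (J (q t)) (J (r t))
        + (Z (q t) (w t) - Z (v t) (r t)))
    (hY : ∀ t, Y t = K (q t) (w t) - K (v t) (r t))
    (h₀ : x₀ = K (v 0) (w 0) + Z (v 0) (w 0) + β * inner ℝ (J (v 0)) (J (w 0))) :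
    (∫ t in (0 : ℝ)..T, X t) + (∫ t in (0 : ℝ)..T, Y t) + x₀ =
      abstractMixedForm T J (K + Z) β v v' q w w' r := by
  have hv' := hv.memLp_val hT
  have hw' := hw.memLp_val hT
  have m1 := intervalIntegrable_bilin hT (massForm J) hv.memLp hw.memLp
  have m2 := intervalIntegrable_bilin hT (massForm J) hq hr
  have z1 := intervalIntegrable_bilin hT Z hq hw'
  have z2 := intervalIntegrable_bilin hT Z hv' hr
  have k1 := intervalIntegrable_bilin hT K hq hw'
  have k2 := intervalIntegrable_bilin hT K hv' hr
  simp only [← massForm_apply] at hX h₀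
  have hXi : IntervalIntegrable X volume 0 T := by
    rw [funext hX]
    exact (m1.add m2).add (z1.sub z2)
  have hYi : IntervalIntegrable Y volume 0 T := by
    rw [funext hY]
    exact k1.sub k2
  rw [← intervalIntegral.integral_add hXi hYi, h₀, abstractMixedForm, form_add_apply]
  congr 2; ext t
  rw [hX, hY, mixedIntegrand, form_add_apply, form_add_apply]
  ring

/-- Elements of `Q` are almost-everywhere classes; this permits passing between a function and the
representative of its class. -/
theorem abstractMixedForm_congr_right (hT : 0 ≤ T) (hrs : r =ᵐ[timeMeasure T] s) :
    abstractMixedForm T J B β v v' q w w' r = abstractMixedForm T J B β v v' q w w' s := by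
  unfold abstractMixedForm
  congr 1
  refine intervalIntegral.integral_congr_ae_restrict ?_
  rw [uIoc_of_le hT]
  filter_upwards [hrs] with t ht
  rw [ht]

theorem abstractMixedForm_sub_left (hT : 0 ≤ T)
    (hv : IsPath T v v') (hq : MemLp q 2 (timeMeasure T))
    (hu : IsPath T u u') (hs : MemLp s 2 (timeMeasure T))
    (hw : IsPath T w w') (hr : MemLp r 2 (timeMeasure T)) :
    abstractMixedForm T J B β (fun t => v t - u t) (fun t => v' t - u' t) (fun t => q t - s t)
        w w' r =
      abstractMixedForm T J B β v v' q w w' r - abstractMixedForm T J B β u u' s w w' r := by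
  unfold abstractMixedForm
  rw [add_sub_add_comm, ← intervalIntegral.integral_sub
    (intervalIntegrable_mixedIntegrand hT J B hv hq hw hr)
    (intervalIntegrable_mixedIntegrand hT J B hu hs hw hr)]
  congr 1
  · congr 1; ext t
    simp only [mixedIntegrand, map_sub, sub_apply]
    ring
  · simp only [map_sub, sub_apply]
    ring

theorem abstractMixedForm_sub_right (hT : 0 ≤ T)
    (hv : IsPath T v v') (hq : MemLp q 2 (timeMeasure T))
    (hu : IsPath T u u') (hs : MemLp s 2 (timeMeasure T))
    (hw : IsPath T w w') (hr : MemLp r 2 (timeMeasure T)) :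
    abstractMixedForm T J B β w w' r (fun t => v t - u t) (fun t => v' t - u' t)
        (fun t => q t - s t) =
      abstractMixedForm T J B β w w' r v v' q - abstractMixedForm T J B β w w' r u u' s := by
  unfold abstractMixedForm
  rw [add_sub_add_comm, ← intervalIntegral.integral_sub
    (intervalIntegrable_mixedIntegrand hT J B hw hr hv hq)
    (intervalIntegrable_mixedIntegrand hT J B hw hr hu hs)]
  congr 1
  · congr 1; ext t
    simp only [mixedIntegrand, map_sub]
    ring
  · simp only [map_sub]
    ring

/-- The mixed form of a symmetric nonnegative form dominates the mixed norm. -/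
theorem integral_norm_sq_le_abstractMixedForm (hsymm : ∀ x y, B x y = B y x)
    (hpos : ∀ x, 0 ≤ B x x) (hβ : 0 ≤ β) :
    ∫ t in (0 : ℝ)..T, (‖J (v' t)‖ ^ 2 + ‖J (q t)‖ ^ 2) ≤
      abstractMixedForm T J B β v v' q v v' q := by
  unfold abstractMixedForm
  -- On the diagonal the cross terms `B q v - B v q` cancel by symmetry.
  have h1 : ∀ t, mixedIntegrand J B (v t) (v' t) (q t) (v t) (v' t) (q t) =
      ‖J (v' t)‖ ^ 2 + ‖J (q t)‖ ^ 2 := by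
    intro t
    simp only [mixedIntegrand, massForm_apply, real_inner_self_eq_norm_sq, hsymm (q t), sub_self,
      add_zero]
  simp only [h1]
  have h3 : 0 ≤ β * massForm J (v 0) (v 0) := by
    rw [massForm_apply, real_inner_self_eq_norm_sq]; positivity
  linarith [hpos (v 0)]

/-- A path that vanishes at the nodes has a derivative orthogonal to the derivative of every grid
affine path. -/
theorem IsPath.integral_massForm_eq_zero [CompleteSpace V] [CompleteSpace H] (hτ : IsTimeGrid T τ)
    (hv : IsPath T v v') (hvτ : IsGridAffine τ v) (hw : IsPath T w w') (hw0 : ∀ i, w (τ i) = 0)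
    (J : V →L[ℝ] H) : ∫ t in (0 : ℝ)..T, massForm J (v' t) (w' t) = 0 := by
  have hT : (0 : ℝ) ≤ T := (hτ.mem_Icc 0).1.trans (hτ.mem_Icc 0).2
  rw [← hτ.sum_integral fun i => hτ.intervalIntegrable
    (intervalIntegrable_bilin hT (massForm J) hv.memLp hw.memLp) i]
  refine Finset.sum_eq_zero fun i _ => ?_
  -- With the derivative of `v` equal to `c`, the integral pairs `c` with the increment of `w`
  -- between two nodes, which is zero.
  obtain ⟨c, hc⟩ := hv.ae_eq_const hτ hvτ i
  rw [intervalIntegral.integral_congr_ae (g := fun t => massForm J c (w' t)),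
    (massForm J c).intervalIntegral_comp_comm
      (hw.intervalIntegrable_of_mem (hτ.mem_Icc _) (hτ.mem_Icc _)),
    hw.integral_eq_sub (hτ.mem_Icc _) (hτ.mem_Icc _), hw0, hw0, sub_zero, map_zero]
  filter_upwards [hc] with t ht hmem
  rw [uIoc_of_le (hτ.lt i).le] at hmem
  rw [ht hmem]

/-- The abstract a posteriori error estimate. -/
theorem abstract_error_estimate [CompleteSpace V] [CompleteSpace H] (hτ : IsTimeGrid T τ)
    (hsymm : ∀ x y, B x y = B y x) (hpos : ∀ x, 0 ≤ B x x) (hβ : 0 ≤ β)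
    {f : ℝ → StrongDual ℝ V} (hf : MemLp f 2 (timeMeasure T))
    {p p' pk pk' y yk : ℝ → V} (hp : IsPath T p p') (hpk : IsPath T pk pk')
    (hy : MemLp y 2 (timeMeasure T)) (hyk : MemLp yk 2 (timeMeasure T))
    (hpkτ : IsGridAffine τ pk)
    (hsol : ∀ w w' r, IsPath T w w' → MemLp r 2 (timeMeasure T) →
      abstractMixedForm T J B β p p' y w w' r = ∫ t in (0 : ℝ)..T, f t (w t))
    (hdisc : ∀ w w' r, IsPath T w w' → MemLp r 2 (timeMeasure T) → IsGridAffine τ w →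
      abstractMixedForm T J B β pk pk' yk w w' r = ∫ t in (0 : ℝ)..T, f t (w t))
    {ρ : ℝ → H}
    (hρ : ∀ᵐ t ∂timeMeasure T, ∀ φ, inner ℝ (ρ t) (J φ) = f t φ - B (yk t) φ)
    (hρ2 : ∀ i : Fin N,
      IntervalIntegrable (fun t => ‖ρ t‖ ^ 2) volume (τ i.castSucc) (τ i.succ)) :
    ∫ t in (0 : ℝ)..T, (‖J (p' t - pk' t)‖ ^ 2 + ‖J (y t - yk t)‖ ^ 2) ≤
      ∑ i : Fin N, (τ i.succ - τ i.castSucc) ^ 2 *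
        ∫ t in (τ i.castSucc)..(τ i.succ), ‖ρ t‖ ^ 2 := by
  have hT : (0 : ℝ) ≤ T := (hτ.mem_Icc 0).1.trans (hτ.mem_Icc 0).2
  have he := hp.sub hpk
  have hE : MemLp (fun t => y t - yk t) 2 (timeMeasure T) := hy.sub hyk
  obtain ⟨u, u', hu, huτ, hnode, hinterp⟩ := he.exists_interpolant hτ
  have hw := he.sub hu
  set e : ℝ → V := fun t => p t - pk t with he_def
  set e' : ℝ → V := fun t => p' t - pk' t with he'_def
  set E : ℝ → V := fun t => y t - yk t with hE_def
  set w : ℝ → V := fun t => e t - u t with hw_def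
  have hw0 : ∀ i, w (τ i) = 0 := fun i => by simp [hw_def, hnode, he_def]
  have hwzero : w 0 = 0 := by rw [← hτ.first]; exact hw0 0
  have horth := hpk.integral_massForm_eq_zero hτ hpkτ hw hw0 J
  have hload : ∫ t in (0 : ℝ)..T, f t (w t) =
      (∫ t in (0 : ℝ)..T, f t (e t)) - ∫ t in (0 : ℝ)..T, f t (u t) := by
    rw [← intervalIntegral.integral_sub (intervalIntegrable_apply hT hf (he.memLp_val hT))
      (intervalIntegrable_apply hT hf (hu.memLp_val hT))]
    simp only [hw_def, map_sub]
  have hB := intervalIntegrable_bilin hT B hyk (hw.memLp_val hT)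
  have hF := intervalIntegrable_apply hT hf (hw.memLp_val hT)
  -- The test pair is `(w, 0)`; the zero appears as `E - E` because it comes from subtracting the
  -- tests `(e, E)` and `(u, E)`.
  have hform : abstractMixedForm T J B β pk pk' yk w (fun t => e' t - u' t)
      (fun t => E t - E t) = ∫ t in (0 : ℝ)..T, B (yk t) (w t) := by
    unfold abstractMixedForm mixedIntegrand
    simp only [hwzero, sub_self, map_zero, add_zero, mul_zero, sub_zero]
    rw [intervalIntegral.integral_add
      (intervalIntegrable_bilin hT (massForm J) hpk.memLp hw.memLp) hB, horth, zero_add]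
  have hmain : ∫ t in (0 : ℝ)..T, (‖J (e' t)‖ ^ 2 + ‖J (E t)‖ ^ 2) ≤
      ∫ t in (0 : ℝ)..T, inner ℝ (ρ t) (J (w t)) := by
    refine (integral_norm_sq_le_abstractMixedForm (v := e) hsymm hpos hβ).trans_eq ?_
    have h1 := abstractMixedForm_sub_left (J := J) (B := B) (β := β) hT hp hy hpk hyk he hE
    refine h1.trans ?_
    rw [hsol e e' E he hE]
    have h2 := abstractMixedForm_sub_right (J := J) (B := B) (β := β) hT he hE hu hE hpk hyk
    rw [hform, hdisc u u' E hu hE huτ] at h2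
    rw [show abstractMixedForm T J B β pk pk' yk e e' E = (∫ t in (0 : ℝ)..T, B (yk t) (w t)) +
      ∫ t in (0 : ℝ)..T, f t (u t) by rw [h2]; ring, ← sub_sub, sub_right_comm, ← hload,
      ← intervalIntegral.integral_sub hF hB]
    refine intervalIntegral.integral_congr_ae_restrict ?_
    rw [uIoc_of_le hT]
    filter_upwards [hρ] with t ht
    rw [ht]
  -- Integrability comes from the residual identity, whose right-hand side pairs functions that are
  -- `L²` in time; no measurability of `ρ` is needed here.
  have hinner : IntervalIntegrable (fun t => inner ℝ (ρ t) (J (w t))) volume 0 T := by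
    refine (hF.sub hB).congr_ae ?_
    rw [uIoc_of_le hT]
    filter_upwards [hρ] with t ht
    simp [ht]
  have hJe : MemLp (fun t => J (e' t)) 2 (timeMeasure T) := J.comp_memLp' he.memLp
  have hJE : MemLp (fun t => J (E t)) 2 (timeMeasure T) := J.comp_memLp' hE
  have hJe2 : IntervalIntegrable (fun t => ‖J (e' t)‖ ^ 2) volume 0 T := by
    rw [intervalIntegrable_iff_integrableOn_Ioc_of_le hT]
    exact hJe.integrable_norm_pow (by norm_num)
  have hJE2 : IntervalIntegrable (fun t => ‖J (E t)‖ ^ 2) volume 0 T := by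
    rw [intervalIntegrable_iff_integrableOn_Ioc_of_le hT]
    exact hJE.integrable_norm_pow (by norm_num)
  have hlocal : ∀ i : Fin N, ∫ t in (τ i.castSucc)..(τ i.succ), inner ℝ (ρ t) (J (w t)) ≤
      1 / 2 * ((τ i.succ - τ i.castSucc) ^ 2 * ∫ t in (τ i.castSucc)..(τ i.succ), ‖ρ t‖ ^ 2)
        + 1 / 2 * ∫ t in (τ i.castSucc)..(τ i.succ), ‖J (e' t)‖ ^ 2 := by
    intro i
    set Y := ∫ t in (τ i.castSucc)..(τ i.succ), ‖J (e' t)‖ ^ 2 with hY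
    set δ := τ i.succ - τ i.castSucc with hδ
    have hδ0 : 0 < δ := sub_pos.2 (hτ.lt i)
    -- Young's inequality with weights `δ` and `δ⁻¹`. The last term is constant in `t`, so
    -- integrating over length `δ` turns it into exactly `Y / 2`.
    have hpt : ∀ t ∈ Icc (τ i.castSucc) (τ i.succ), inner ℝ (ρ t) (J (w t)) ≤
        1 / 2 * δ ^ 2 * ‖ρ t‖ ^ 2 + 1 / 2 * δ⁻¹ * Y := by
      intro t ht
      have h1 : ‖J (w t)‖ ^ 2 ≤ δ * Y := by
        simp only [hw_def]
        rw [hinterp i t ht]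
        exact he.norm_interpolation_error_sq_le J (hτ.lt i) (hτ.mem_Icc _) (hτ.mem_Icc _) ht
      have h2 : δ⁻¹ ^ 2 * ‖J (w t)‖ ^ 2 ≤ δ⁻¹ * Y := by
        calc δ⁻¹ ^ 2 * ‖J (w t)‖ ^ 2 ≤ δ⁻¹ ^ 2 * (δ * Y) := by gcongr
          _ = δ⁻¹ * Y := by field_simp
      have h3 : ‖ρ t‖ * ‖J (w t)‖ = (δ * ‖ρ t‖) * (δ⁻¹ * ‖J (w t)‖) := by field_simp
      have h4 := real_inner_le_norm (ρ t) (J (w t))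
      rw [h3] at h4
      nlinarith [sq_nonneg (δ * ‖ρ t‖ - δ⁻¹ * ‖J (w t)‖)]
    refine (intervalIntegral.integral_mono_on (hτ.lt i).le (hτ.intervalIntegrable hinner i)
      (((hρ2 i).const_mul _).add (by simp)) hpt).trans_eq ?_
    rw [intervalIntegral.integral_add ((hρ2 i).const_mul _) (by simp),
      intervalIntegral.integral_const_mul, intervalIntegral.integral_const, smul_eq_mul, ← hδ]
    field_simp
  rw [← hτ.sum_integral fun i => hτ.intervalIntegrable hinner i] at hmain
  have hsum := hmain.trans (Finset.sum_le_sum fun i _ => hlocal i)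
  rw [Finset.sum_add_distrib, ← Finset.mul_sum, ← Finset.mul_sum,
    hτ.sum_integral fun i => hτ.intervalIntegrable hJe2 i] at hsum
  -- This allows the half of `∫ ‖J e'‖²` on the right to be absorbed into the left side, which also
  -- doubles the factor `1 / 2` of the estimator to 1.
  have hle : ∫ t in (0 : ℝ)..T, ‖J (e' t)‖ ^ 2 ≤
      ∫ t in (0 : ℝ)..T, (‖J (e' t)‖ ^ 2 + ‖J (E t)‖ ^ 2) :=
    intervalIntegral.integral_mono_on hT hJe2 (hJe2.add hJE2) fun t _ => by
      linarith [sq_nonneg ‖J (E t)‖]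
  linarith

end Estimate

/-! ### The elliptic operator as a bounded bilinear form on `H₀¹(Ω)` -/

section Forms

variable {d : ℕ} {Ω : Set (EuclideanSpace ℝ (Fin d))}

/-- The bounded bilinear form `(u, v) ↦ ∫_Ω c u v` on `L²(Ω)` for `c ∈ L^∞(Ω)`. -/
def weightForm {c : EuclideanSpace ℝ (Fin d) → ℝ} (hc : MemLp c ∞ (volume.restrict Ω)) :
    L2 Ω →L[ℝ] L2 Ω →L[ℝ] ℝ :=
  ((ContinuousLinearMap.mul ℝ ℝ).lpPairing (volume.restrict Ω) 2 2).comp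
    ((ContinuousLinearMap.mul ℝ ℝ).holderL (volume.restrict Ω) ∞ 2 2 (hc.toLp c))

theorem integrable_mul_L2 (u v : L2 Ω) :
    Integrable (fun x => u x * v x) (volume.restrict Ω) :=
  MemLp.integrable_mul (Lp.memLp u) (Lp.memLp v)

theorem integrable_weight_mul {c : EuclideanSpace ℝ (Fin d) → ℝ}
    (hc : MemLp c ∞ (volume.restrict Ω)) (u v : L2 Ω) :
    Integrable (fun x => c x * u x * v x) (volume.restrict Ω) :=
  MemLp.integrable_mul (p := 2) (q := 2) ((Lp.memLp u).mul hc) (Lp.memLp v)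

theorem weightForm_apply {c : EuclideanSpace ℝ (Fin d) → ℝ}
    (hc : MemLp c ∞ (volume.restrict Ω)) (u v : L2 Ω) :
    weightForm hc u v = ∫ x in Ω, c x * u x * v x := by
  rw [weightForm, ContinuousLinearMap.comp_apply, ContinuousLinearMap.lpPairing_eq_integral]
  refine integral_congr_ae ?_
  filter_upwards [(ContinuousLinearMap.mul ℝ ℝ).coeFn_holder (r := 2) (hc.toLp c) u,
    hc.coeFn_toLp] with x h1 h2
  simp [h1, h2]

theorem inner_eq_integral_mul (u v : L2 Ω) : inner ℝ u v = ∫ x in Ω, u x * v x := by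
  rw [L2.inner_def]
  simp [mul_comm]

theorem norm_sq_eq_integral_sq (u : L2 Ω) : ‖u‖ ^ 2 = ∫ x in Ω, u x ^ 2 := by
  rw [← real_inner_self_eq_norm_sq, inner_eq_integral_mul]
  simp only [sq]

theorem integrable_sq_L2 (u : L2 Ω) : Integrable (fun x => u x ^ 2) (volume.restrict Ω) :=
  (integrable_mul_L2 u u).congr (Filter.Eventually.of_forall fun x => (sq (u x)).symm)

theorem integral_mixed_lower_order {a₀ : EuclideanSpace ℝ (Fin d) → ℝ}
    (h₀ : MemLp a₀ ∞ (volume.restrict Ω)) (v v' q w w' r : L2 Ω) :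
    ∫ x in Ω, (v' x * w' x + q x * r x + a₀ x * (q x * w x - v x * r x)) =
      inner ℝ v' w' + inner ℝ q r + (weightForm h₀ q w - weightForm h₀ v r) := by
  have i1 := integrable_mul_L2 v' w'
  have i2 := integrable_mul_L2 q r
  have i3 := integrable_weight_mul h₀ q w
  have i4 := integrable_weight_mul h₀ v r
  rw [inner_eq_integral_mul, inner_eq_integral_mul, weightForm_apply, weightForm_apply,
    ← integral_add i1 i2, ← integral_sub i3 i4]
  refine Eq.trans ?_ (integral_add (i1.add i2) (i3.sub i4))
  congr 1; ext x; ring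

theorem integral_initial_lower_order {a₀ g : EuclideanSpace ℝ (Fin d) → ℝ}
    (h₀ : MemLp a₀ ∞ (volume.restrict Ω)) (hg : Integrable g (volume.restrict Ω)) (β : ℝ)
    (v w : L2 Ω) :
    ∫ x in Ω, (g x + (a₀ x + β) * v x * w x) =
      (∫ x in Ω, g x) + weightForm h₀ v w + β * inner ℝ v w := by
  have i2 := integrable_weight_mul h₀ v w
  have i3 := (integrable_mul_L2 v w).const_mul β
  rw [inner_eq_integral_mul, weightForm_apply, ← integral_const_mul, ← integral_add hg i2]
  refine Eq.trans ?_ (integral_add (hg.add i2) i3)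
  congr 1; ext x; ring

/-- The `L²(Ω)` function of an element of `H₀¹(Ω)`, as a continuous linear map. -/
def fnL (Ω : Set (EuclideanSpace ℝ (Fin d))) : H01 Ω →L[ℝ] L2 Ω :=
  (WithLp.fstL 2 ℝ _ _).comp (Submodule.subtypeL _)

/-- A partial derivative of an element of `H₀¹(Ω)`, as a continuous linear map. -/
def partialL (Ω : Set (EuclideanSpace ℝ (Fin d))) (j : Fin d) : H01 Ω →L[ℝ] L2 Ω :=
  ((EuclideanSpace.proj j : EuclideanSpace ℝ (Fin d) →L[ℝ] ℝ).compLpL 2 (volume.restrict Ω)).comp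
    ((WithLp.sndL 2 ℝ _ _).comp (Submodule.subtypeL _))

theorem coeFn_partialL (j : Fin d) (v : H01 Ω) :
    partialL Ω j v =ᵐ[volume.restrict Ω] fun x => v.grad x j :=
  ContinuousLinearMap.coeFn_compLpL (p := 2)
    (EuclideanSpace.proj j : EuclideanSpace ℝ (Fin d) →L[ℝ] ℝ) v.grad

/-- The zeroth order form `∫_Ω a₀ v w` on `H₀¹(Ω)`. -/
def zeroForm {a₀ : EuclideanSpace ℝ (Fin d) → ℝ} (h₀ : MemLp a₀ ∞ (volume.restrict Ω)) :
    H01 Ω →L[ℝ] H01 Ω →L[ℝ] ℝ :=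
  (weightForm h₀).bilinearComp (fnL Ω) (fnL Ω)

theorem zeroForm_apply {a₀ : EuclideanSpace ℝ (Fin d) → ℝ}
    (h₀ : MemLp a₀ ∞ (volume.restrict Ω)) (v w : H01 Ω) :
    zeroForm h₀ v w = weightForm h₀ v.fn w.fn := rfl

/-- The second order form `∫_Ω A ∇v · ∇w` on `H₀¹(Ω)`. -/
def fluxForm {a : Fin d → Fin d → EuclideanSpace ℝ (Fin d) → ℝ}
    (ha : ∀ i j, MemLp (a i j) ∞ (volume.restrict Ω)) : H01 Ω →L[ℝ] H01 Ω →L[ℝ] ℝ :=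
  ∑ i, ∑ j, (weightForm (ha i j)).bilinearComp (partialL Ω j) (partialL Ω i)

variable {a : Fin d → Fin d → EuclideanSpace ℝ (Fin d) → ℝ}
  {a₀ : EuclideanSpace ℝ (Fin d) → ℝ}

theorem weight_partial_ae_eq (c : EuclideanSpace ℝ (Fin d) → ℝ) (v w : H01 Ω) (i j : Fin d) :
    (fun x => c x * partialL Ω j v x * partialL Ω i w x) =ᵐ[volume.restrict Ω]
      fun x => c x * v.grad x j * w.grad x i := by
  filter_upwards [coeFn_partialL j v, coeFn_partialL i w] with x h1 h2
  rw [h1, h2]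

theorem integrable_flux_term (ha : ∀ i j, MemLp (a i j) ∞ (volume.restrict Ω)) (v w : H01 Ω)
    (i j : Fin d) :
    Integrable (fun x => a i j x * v.grad x j * w.grad x i) (volume.restrict Ω) :=
  (integrable_weight_mul (ha i j) _ _).congr (weight_partial_ae_eq _ v w i j)

theorem integrable_flux (ha : ∀ i j, MemLp (a i j) ∞ (volume.restrict Ω)) (v w : H01 Ω) :
    Integrable (flux a v w) (volume.restrict Ω) :=
  integrable_finsetSum _ fun i _ => integrable_finsetSum _ fun j _ =>
    integrable_flux_term ha v w i j

theorem fluxForm_apply (ha : ∀ i j, MemLp (a i j) ∞ (volume.restrict Ω)) (v w : H01 Ω) :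
    fluxForm ha v w = ∫ x in Ω, flux a v w x := by
  unfold flux
  rw [integral_finsetSum _ fun i _ => integrable_finsetSum _ fun j _ =>
    integrable_flux_term ha v w i j]
  simp only [fluxForm, sum_apply, ContinuousLinearMap.bilinearComp_apply]
  refine Finset.sum_congr rfl fun i _ => ?_
  rw [integral_finsetSum _ fun j _ => integrable_flux_term ha v w i j]
  refine Finset.sum_congr rfl fun j _ => ?_
  rw [weightForm_apply]
  exact integral_congr_ae (weight_partial_ae_eq _ v w i j)

theorem fluxForm_symm (ha : ∀ i j, MemLp (a i j) ∞ (volume.restrict Ω))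
    (hs : ∀ i j, a i j =ᵐ[volume.restrict Ω] a j i) (v w : H01 Ω) :
    fluxForm ha v w = fluxForm ha w v := by
  rw [fluxForm_apply, fluxForm_apply]
  have hs' : ∀ᵐ x ∂volume.restrict Ω, ∀ i j, a i j x = a j i x :=
    ae_all_iff.2 fun i => ae_all_iff.2 fun j => hs i j
  refine integral_congr_ae ?_
  filter_upwards [hs'] with x hx
  unfold flux
  rw [Finset.sum_comm]
  refine Finset.sum_congr rfl fun i _ => Finset.sum_congr rfl fun j _ => ?_
  rw [hx]; ring

theorem zeroForm_symm (h₀ : MemLp a₀ ∞ (volume.restrict Ω)) (v w : H01 Ω) :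
    zeroForm h₀ v w = zeroForm h₀ w v := by
  rw [zeroForm_apply, zeroForm_apply, weightForm_apply, weightForm_apply]
  congr 1; ext x; ring

/-- The bounded bilinear form of the operator `𝒜`. -/
def operatorForm (ha : ∀ i j, MemLp (a i j) ∞ (volume.restrict Ω))
    (h₀ : MemLp a₀ ∞ (volume.restrict Ω)) : H01 Ω →L[ℝ] H01 Ω →L[ℝ] ℝ :=
  fluxForm ha + zeroForm h₀

theorem operatorForm_apply (ha : ∀ i j, MemLp (a i j) ∞ (volume.restrict Ω))
    (h₀ : MemLp a₀ ∞ (volume.restrict Ω)) (v w : H01 Ω) :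
    operatorForm ha h₀ v w = fluxForm ha v w + zeroForm h₀ v w :=
  form_add_apply (fluxForm ha) (zeroForm h₀) v w

theorem operatorForm_symm (ha : ∀ i j, MemLp (a i j) ∞ (volume.restrict Ω))
    (h₀ : MemLp a₀ ∞ (volume.restrict Ω)) (hs : ∀ i j, a i j =ᵐ[volume.restrict Ω] a j i)
    (v w : H01 Ω) : operatorForm ha h₀ v w = operatorForm ha h₀ w v :=
  congrArg₂ (· + ·) (fluxForm_symm ha hs v w) (zeroForm_symm h₀ v w)

theorem operatorForm_eq_ellipticForm (ha : ∀ i j, MemLp (a i j) ∞ (volume.restrict Ω))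
    (h₀ : MemLp a₀ ∞ (volume.restrict Ω)) (v w : H01 Ω) :
    operatorForm ha h₀ v w = ellipticForm Ω a a₀ v w := by
  rw [operatorForm_apply, ellipticForm, fluxForm_apply, zeroForm_apply, weightForm_apply,
    integral_add (integrable_flux ha v w) (integrable_weight_mul h₀ _ _)]

end Forms

/-! ### From the concrete formulation to the abstract estimate -/

section Link

variable {d : ℕ} {Ω : Set (EuclideanSpace ℝ (Fin d))} {T : ℝ}
  {a : Fin d → Fin d → EuclideanSpace ℝ (Fin d) → ℝ} {a₀ : EuclideanSpace ℝ (Fin d) → ℝ}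

theorem SpaceP.isPath (v : SpaceP Ω T) : IsPath T v.val v.dt := ⟨v.memLp_dt, v.val_eq, v.val_end⟩

/-- The element of `P` given by an absolutely continuous path. -/
def IsPath.toSpaceP {v v' : ℝ → H01 Ω} (h : IsPath T v v') : SpaceP Ω T :=
  ⟨v, v', h.memLp, h.eq, h.vanish⟩

theorem mixedForm_eq (hT : 0 ≤ T) (α : ℝ) (ha : ∀ i j, MemLp (a i j) ∞ (volume.restrict Ω))
    (h₀ : MemLp a₀ ∞ (volume.restrict Ω)) (v w : SpaceP Ω T) (q r : SpaceQ Ω T) :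
    mixedForm Ω T a a₀ α v q w r =
      abstractMixedForm T (fnL Ω) (operatorForm ha h₀) (1 / α) v.val v.dt q w.val w.dt r :=
  abstractMixedForm_eq_of_split hT v.isPath (Lp.memLp q) w.isPath (Lp.memLp r)
    (fun _ => integral_mixed_lower_order h₀ _ _ _ _ _ _)
    (fun _ => (integral_sub (integrable_flux ha _ _) (integrable_flux ha _ _)).trans
      (congrArg₂ (· - ·) (fluxForm_apply ha _ _).symm (fluxForm_apply ha _ _).symm))
    ((integral_initial_lower_order h₀ (integrable_flux ha _ _) _ _ _).trans
      (congrArg (fun z => z + zeroForm h₀ (v.val 0) (w.val 0)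
        + 1 / α * inner ℝ (fnL Ω (v.val 0)) (fnL Ω (w.val 0))) (fluxForm_apply ha _ _).symm))

theorem normM_sub_sq (hT : 0 ≤ T) (v w : SpaceP Ω T) (q r : SpaceQ Ω T) :
    normM (v - w) (q - r) ^ 2 =
      ∫ t in (0 : ℝ)..T, (‖fnL Ω (v.dt t - w.dt t)‖ ^ 2 + ‖fnL Ω (q t - r t)‖ ^ 2) := by
  have key : ∀ t, (∫ x in Ω, ((((v - w).dt t).fn x) ^ 2 + (((q - r) t).fn x) ^ 2)) =
      ‖fnL Ω (v.dt t - w.dt t)‖ ^ 2 + ‖fnL Ω ((q - r) t)‖ ^ 2 := fun t =>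
    (integral_add (integrable_sq_L2 _) (integrable_sq_L2 _)).trans
      (congrArg₂ (· + ·) (norm_sq_eq_integral_sq _).symm (norm_sq_eq_integral_sq _).symm)
  unfold normM
  simp only [key]
  rw [Real.sq_sqrt (intervalIntegral.integral_nonneg hT fun t _ => by positivity)]
  -- The chosen representative of `q - r` equals the pointwise difference only almost everywhere in
  -- time.
  refine intervalIntegral.integral_congr_ae_restrict ?_
  rw [uIoc_of_le hT]
  filter_upwards [Lp.coeFn_sub q r] with t ht
  rw [ht, Pi.sub_apply]

/-- The second time derivative of a grid affine function vanishes inside the intervals. -/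
theorem ae_iteratedDeriv_two_eq_zero {V : Type*} [NormedAddCommGroup V] [NormedSpace ℝ V] {N : ℕ}
    {τ : Fin (N + 1) → ℝ} {v : ℝ → V} (hv : IsGridAffine τ v) (i : Fin N) :
    ∀ᵐ t, t ∈ Ioc (τ i.castSucc) (τ i.succ) → iteratedDeriv 2 v t = 0 := by
  obtain ⟨b, c, hbc⟩ := hv i
  have hne : ∀ᵐ t : ℝ, t ≠ τ i.succ := by simp [ae_iff, measure_singleton]
  filter_upwards [hne] with t h2 hmem
  have hmem' : t ∈ Ioo (τ i.castSucc) (τ i.succ) := ⟨hmem.1, lt_of_le_of_ne hmem.2 h2⟩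
  have h1 : v =ᶠ[nhds t] fun s => b + s • c := by
    filter_upwards [Ioo_mem_nhds hmem'.1 hmem'.2] with s hs
    exact hbc s (Ioo_subset_Ioc_self hs)
  rw [h1.iteratedDeriv_eq]
  have hd : deriv (fun s : ℝ => b + s • c) = fun _ => c := by
    ext s
    have : HasDerivAt (fun s : ℝ => b + s • c) c s := by
      simpa using ((hasDerivAt_id s).smul_const c).const_add b
    rw [this.deriv]
  rw [iteratedDeriv_succ, iteratedDeriv_one, hd, deriv_const]

theorem IsTimeGrid.ae_of_forall {N : ℕ} {τ : Fin (N + 1) → ℝ} (h : IsTimeGrid T τ)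
    {P : ℝ → Prop} (hP : ∀ i : Fin N, ∀ᵐ t, t ∈ Ioc (τ i.castSucc) (τ i.succ) → P t) :
    ∀ᵐ t ∂timeMeasure T, P t := by
  rw [ae_restrict_iff' measurableSet_Ioc]
  filter_upwards [ae_all_iff.2 hP] with t ht hmem
  obtain ⟨i, hi⟩ : ∃ i : Fin N, t ∈ Ioc (τ i.castSucc) (τ i.succ) := by
    -- If no interval contained `t`, induction from `τ 0 = 0 < t` would place every node strictly
    -- below `t`, contradicting `t ≤ T` at the last one.
    by_contra! hno
    have hall : ∀ k : Fin (N + 1), τ k < t := by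
      intro k
      induction k using Fin.induction with
      | zero => rw [h.first]; exact hmem.1
      | succ k ih => exact not_le.1 fun hle => hno k ⟨ih, hle⟩
    exact absurd (hall (Fin.last N)) (not_lt.2 (h.last ▸ hmem.2))
  exact ht i hi

theorem lintegral_ofReal_weighted_sq (δ : ℝ) (u : L2 Ω) :
    ∫⁻ x in Ω, ENNReal.ofReal (δ ^ 2 * u x ^ 2) = ENNReal.ofReal (δ ^ 2 * ‖u‖ ^ 2) := by
  rw [norm_sq_eq_integral_sq, ← integral_const_mul,
    ofReal_integral_eq_lintegral_ofReal ((integrable_sq_L2 u).const_mul _)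
      (Filter.Eventually.of_forall fun x => by positivity)]

/-- The mixed a posteriori bound for one representation `r` of the residual. -/
theorem normM_sub_sq_le_of_isResidual {α : ℝ} {f : SourceSpace Ω T} {N : ℕ}
    {τ : Fin (N + 1) → ℝ} {p pk : SpaceP Ω T} {q qk : SpaceQ Ω T} (hα : 0 < α)
    (ha : ∀ i j, MemLp (a i j) ∞ (volume.restrict Ω)) (h₀ : MemLp a₀ ∞ (volume.restrict Ω))
    (hs : ∀ i j, a i j =ᵐ[volume.restrict Ω] a j i)
    (hpos : ∀ v : H01 Ω, 0 ≤ ellipticForm Ω a a₀ v v) (hτ : IsTimeGrid T τ)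
    (hsol : IsMixedSolution Ω T a a₀ α f p q)
    (hdisc : IsSemiDiscreteSolution Ω T a a₀ α f τ pk qk) {r : ℝ → L2 Ω}
    (hr : IsResidual Ω T a a₀ f pk qk r) :
    ENNReal.ofReal (normM (p - pk) (q - qk) ^ 2) ≤
      ∑ i : Fin N, ∫⁻ t in Ioc (τ i.castSucc) (τ i.succ), ∫⁻ x in Ω,
        ENNReal.ofReal ((τ i.succ - τ i.castSucc) ^ 2 * (r t x) ^ 2) := by
  have hT : (0 : ℝ) ≤ T := (hτ.mem_Icc 0).1.trans (hτ.mem_Icc 0).2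
  simp only [lintegral_ofReal_weighted_sq]
  -- `IsResidual` gives measurability but no square integrability. An infinite local contribution
  -- makes the bound trivial; otherwise the residual is square integrable on each interval.
  by_cases hfin : ∃ i : Fin N, ∫⁻ t in Ioc (τ i.castSucc) (τ i.succ),
      ENNReal.ofReal ((τ i.succ - τ i.castSucc) ^ 2 * ‖r t‖ ^ 2) = (⊤ : ℝ≥0∞)
  · obtain ⟨i, hi⟩ := hfin
    exact le_top.trans_eq (ENNReal.sum_eq_top.2 ⟨i, Finset.mem_univ i, hi⟩).symm
  push Not at hfin
  have hint : ∀ i : Fin N, IntegrableOn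
      (fun t => (τ i.succ - τ i.castSucc) ^ 2 * ‖r t‖ ^ 2) (Ioc (τ i.castSucc) (τ i.succ)) := by
    intro i
    have hm : AEStronglyMeasurable r (volume.restrict (Ioc (τ i.castSucc) (τ i.succ))) :=
      hr.1.mono_measure (Measure.restrict_mono (hτ.Ioc_subset i) le_rfl)
    refine (lintegral_ofReal_ne_top_iff_integrable ((hm.norm.pow 2).const_mul _)
      (Filter.Eventually.of_forall fun t => mul_nonneg (sq_nonneg _) (sq_nonneg _))).1 (hfin i)
  have hzero : ∀ᵐ t ∂timeMeasure T, iteratedDeriv 2 pk.val t = 0 :=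
    hτ.ae_of_forall (ae_iteratedDeriv_two_eq_zero (V := H01 Ω) hdisc.1)
  have hres : ∀ᵐ t ∂timeMeasure T, ∀ φ : H01 Ω,
      inner ℝ (r t) (fnL Ω φ) = f t φ - operatorForm ha h₀ (qk t) φ := by
    filter_upwards [hr.2, hzero] with t ht h2 φ
    have h3 : ∫ x in Ω, (iteratedDeriv 2 pk.val t).fn x * φ.fn x = 0 := by
      rw [h2]
      exact (inner_eq_integral_mul _ _).symm.trans (inner_zero_left _)
    have h4 := ht φ
    rw [h3, add_zero] at h4
    exact ((inner_eq_integral_mul _ _).trans h4).trans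
      (congrArg (f t φ - ·) (operatorForm_eq_ellipticForm ha h₀ _ _).symm)
  have hsol' : ∀ w w' s, IsPath T w w' → MemLp s 2 (timeMeasure T) →
      abstractMixedForm T (fnL Ω) (operatorForm ha h₀) (1 / α) p.val p.dt q w w' s =
        ∫ t in (0 : ℝ)..T, f t (w t) := fun w w' s hw hs' => by
    refine (abstractMixedForm_congr_right hT hs'.coeFn_toLp).symm.trans ?_
    exact (mixedForm_eq hT α ha h₀ p hw.toSpaceP q (hs'.toLp s)).symm.trans
      (hsol hw.toSpaceP (hs'.toLp s))
  have hdisc' : ∀ w w' s, IsPath T w w' → MemLp s 2 (timeMeasure T) → IsGridAffine τ w →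
      abstractMixedForm T (fnL Ω) (operatorForm ha h₀) (1 / α) pk.val pk.dt qk w w' s =
        ∫ t in (0 : ℝ)..T, f t (w t) := fun w w' s hw hs' hwτ => by
    refine (abstractMixedForm_congr_right hT hs'.coeFn_toLp).symm.trans ?_
    exact (mixedForm_eq hT α ha h₀ pk hw.toSpaceP qk (hs'.toLp s)).symm.trans
      (hdisc.2 hw.toSpaceP (hs'.toLp s) hwτ)
  have hpos' : ∀ v : H01 Ω, 0 ≤ operatorForm ha h₀ v v := fun v =>
    (hpos v).trans_eq (operatorForm_eq_ellipticForm ha h₀ v v).symm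
  have hmain := abstract_error_estimate hτ (operatorForm_symm ha h₀ hs) hpos'
    (one_div_pos.2 hα).le (Lp.memLp f) p.isPath pk.isPath (Lp.memLp q) (Lp.memLp qk) hdisc.1
    hsol' hdisc' hres fun i => by
      have hne : (τ i.succ - τ i.castSucc) ^ 2 ≠ 0 := pow_ne_zero _ (sub_pos.2 (hτ.lt i)).ne'
      rw [intervalIntegrable_iff_integrableOn_Ioc_of_le (hτ.lt i).le]
      exact (integrable_const_mul_iff hne.isUnit _).1 (hint i)
  rw [normM_sub_sq hT]
  refine (ENNReal.ofReal_le_ofReal hmain).trans_eq ?_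
  rw [ENNReal.ofReal_sum_of_nonneg fun i _ => mul_nonneg (sq_nonneg _)
    (intervalIntegral.integral_nonneg (hτ.lt i).le fun t _ => sq_nonneg _)]
  refine Finset.sum_congr rfl fun i _ => ?_
  rw [← intervalIntegral.integral_const_mul, intervalIntegral.integral_of_le (hτ.lt i).le]
  exact ofReal_integral_eq_lintegral_ofReal (hint i)
    (Filter.Eventually.of_forall fun t => by positivity)

end Link

end MixedEvolution
end

theorem mainTheorem6 :
    ∃ C : ℝ, 0 < C ∧
      ∀ (d : ℕ) (Ω : Set (EuclideanSpace ℝ (Fin d))) (T α : ℝ)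
        (a : Fin d → Fin d → EuclideanSpace ℝ (Fin d) → ℝ) (a₀ : EuclideanSpace ℝ (Fin d) → ℝ)
        (f : MixedEvolution.SourceSpace Ω T) (N : ℕ) (τ : Fin (N + 1) → ℝ)
        (p pk : MixedEvolution.SpaceP Ω T) (q qk : MixedEvolution.SpaceQ Ω T),
        IsOpen Ω → Bornology.IsBounded Ω → 0 < T → 0 < α →
        (∀ i j, MemLp (a i j) ∞ (volume.restrict Ω)) →
        MemLp a₀ ∞ (volume.restrict Ω) →
        (∀ i j, a i j =ᵐ[volume.restrict Ω] a j i) →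
        (∃ γ : ℝ, 0 < γ ∧ ∀ v : MixedEvolution.H01 Ω,
          γ * ‖v‖ ^ 2 ≤ MixedEvolution.ellipticForm Ω a a₀ v v) →
        MixedEvolution.IsTimeGrid T τ →
        MixedEvolution.IsMixedSolution Ω T a a₀ α f p q →
        MixedEvolution.IsSemiDiscreteSolution Ω T a a₀ α f τ pk qk →
        ENNReal.ofReal (MixedEvolution.normM (p - pk) (q - qk) ^ 2) ≤
          ENNReal.ofReal C * MixedEvolution.etaSq Ω T a a₀ f τ pk qk := by
  -- Young's two halves give `C = 1`.
  refine ⟨1, one_pos, ?_⟩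
  intro d Ω T α a a₀ f N τ p pk q qk _ _ _ hα ha h₀ hs hcoer hτ hsol hdisc
  obtain ⟨γ, hγ, hcoer⟩ := hcoer
  rw [ENNReal.ofReal_one, one_mul]
  -- The bound holds for every representation of the residual, hence for the infimum; with no
  -- representation the infimum is `∞`.
  exact le_iInf₂ fun r hr => MixedEvolution.normM_sub_sq_le_of_isResidual hα ha h₀ hs
    (fun v => (by positivity : (0 : ℝ) ≤ γ * ‖v‖ ^ 2).trans (hcoer v)) hτ hsol hdisc hr
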